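/- A \emph{tower of algebras} is a graded (associative, unital) algebra $A=\bigoplus_{n\ge 0}A_n$ over $\mathbb C$ with multiplication $\rho$ such that: (1) each $A_n$ is in addition a finite-dimensional unital $\mathbb C$-algebra by itself (with its own internal multiplication and unit $1_n$), and $A_0\cong\mathbb C$; (2) for all $m,n$ the external multiplication $\rho_{m,n}\colon A_m\otimes A_n\to A_{m+n}$ is an injective homomorphism of algebras sending $1_m\otimes 1_n$ to $1_{m+n}$; (3) for all $m,n$ the algebra $A_{m+n}$ is projective both as a left and as a right $A_m\otimes A_n$-module, acting through $\rho_{m,n}$. For a finite-dimensional algebra $B$ let $G_0(B)$ (resp. $K_0(B)$) be the Grothendieck group of the category of finitely generated (resp. finitely generated projective) left $B$-modules, i.e. the abelian group generated by the modules $M$ of that category with a relation $[M]=[L]+[N]$ for each exact sequence $0\to L\to M\to N\to 0$ in it. Put $G(A)=\bigoplus_n G_0(A_n)$ and $K(A)=\bigoplus_n K_0(A_n)$. On each of the two define, for modules $M$ over $A_m$ and $N$ over $A_n$, $$[M]\,[N]=\bigl[\mathrm{Ind}^{A_{m+n}}_{A_m\otimes A_n}(M\otimes N)\bigr],\qquad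 \Delta([N])=\sum_{k+l=n}\bigl[\mathrm{Res}^{A_n}_{A_k\otimes A_l}N\bigr],$$ where the Grothendieck group of $A_k\otimes A_l$ is identified with the tensor product of those of $A_k$ and $A_l$ via $[X\otimes Y]\leftrightarrow[X]\otimes[Y]$; the unit is the class of the $A_0$-module $A_0$, and the counit is $[M]\mapsto\dim M$ in degree $0$ and $0$ in positive degrees. The pairing $\langle\cdot,\cdot\rangle\colon K(A)\times G(A)\to\mathbb Z$ is $\langle[P],[M]\rangle=\dim_{\mathbb C}\mathrm{Hom}_{A_n}(P,M)$ if $P$ and $M$ are both $A_n$-modules, and $0$ for different degrees. One says that $G(A)$ and $K(A)$ \emph{form a pair of graded dual Hopf algebras} if these operations make each of them a Hopf algebra over $\mathbb Z$ and if the pairing is perfect in each degree and satisfies $\langle xy,z\rangle=\langle x\otimes y,\Delta z\rangle$, $\langle x,zw\rangle=\langle\Delta x,z\otimes w\rangle$, $\langle 1,z\rangle=\varepsilon(z)$ and $\langle x,1\rangle=\varepsilon(x)$ for all $x,y\in K(A)$ and $z,w\in G(A)$. \textbf{Theorem.} Let $A=\bigoplus_{n\ge0}A_n$ be a tower of algebras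 such that $G(A)$ and $K(A)$ form a pair of graded dual Hopf algebras. Then for all $n\ge0$ $$\dim_{\mathbb C} A_n=r^n\,n!,\qquad\text{where } r=\dim_{\mathbb C} A_1.$$ -/

import Mathlib

open scoped TensorProduct DirectSum

universe u

set_option linter.style.haveILetI false
set_option linter.unusedSectionVars false

namespace AlgebraTower

/-! ### Finitely generated modules over a complex algebra -/

section Modules

variable (B : Type u) [Ring B] [Algebra ℂ B]

/-- A finitely generated left module over the complex algebra `B`. The underlying complex vector
space structure is recorded, and it is the one induced by `ℂ → B`. -/
structure FinMod where
  carrier : Type u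
  [addCommGroup : AddCommGroup carrier]
  [complexModule : Module ℂ carrier]
  [module : Module B carrier]
  [isScalarTower : IsScalarTower ℂ B carrier]
  [finite : Module.Finite B carrier]

attribute [instance] FinMod.addCommGroup FinMod.complexModule FinMod.module
  FinMod.isScalarTower FinMod.finite

/-- The two categories of modules used: all finitely generated modules, or the finitely generated
projective ones. -/
inductive ModKind where
  | all
  | projective

variable {B}

/-- Membership of a finitely generated module in one of the two categories. -/
def ModKind.Mem : ModKind → FinMod B → Prop
  | .all, _ => True
  | .projective, M => Module.Projective B M.carrier

variable (B) in
/-- The left regular module. -/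
def FinMod.regular : FinMod B where
  carrier := B

theorem ModKind.mem_regular (κ : ModKind) : κ.Mem (FinMod.regular B) := by
  cases κ
  · trivial
  · exact inferInstanceAs (Module.Projective B B)

/-! ### Grothendieck groups -/

/-- The objects of the category of kind `κ`. -/
abbrev KindMod (κ : ModKind) (B : Type u) [Ring B] [Algebra ℂ B] : Type (u + 1) :=
  {M : FinMod B // κ.Mem M}

/-- `L → M → N` is a short exact sequence `0 → L → M → N → 0`. -/
def IsShortExact {L M N : FinMod B} (f : L.carrier →ₗ[B] M.carrier)
    (g : M.carrier →ₗ[B] N.carrier) : Prop :=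
  Function.Injective f ∧ Function.Exact f g ∧ Function.Surjective g

/-- The relations `(M) - (L) - (N)`, one for each short exact sequence `0 → L → M → N → 0`
in the category of kind `κ`. (Isomorphic modules are identified by the sequences with `N = 0`.) -/
def sesRelations (κ : ModKind) (B : Type u) [Ring B] [Algebra ℂ B] :
    Set (FreeAbelianGroup (KindMod κ B)) :=
  {x | ∃ (L M N : KindMod κ B) (f : L.1.carrier →ₗ[B] M.1.carrier)
      (g : M.1.carrier →ₗ[B] N.1.carrier), IsShortExact f g ∧
      x = FreeAbelianGroup.of M - FreeAbelianGroup.of L - FreeAbelianGroup.of N}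

/-- The Grothendieck group of the category of kind `κ` of left `B`-modules:
`G₀(B)` for `κ = .all` and `K₀(B)` for `κ = .projective`. -/
def Groth (κ : ModKind) (B : Type u) [Ring B] [Algebra ℂ B] : Type (u + 1) :=
  FreeAbelianGroup (KindMod κ B) ⧸ AddSubgroup.closure (sesRelations κ B)

noncomputable instance (κ : ModKind) (B : Type u) [Ring B] [Algebra ℂ B] :
    AddCommGroup (Groth κ B) :=
  inferInstanceAs
    (AddCommGroup (FreeAbelianGroup (KindMod κ B) ⧸ AddSubgroup.closure (sesRelations κ B)))

/-- The class `[M]` of a module in the Grothendieck group. -/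
noncomputable def Groth.cls {κ : ModKind} (M : KindMod κ B) : Groth κ B :=
  QuotientAddGroup.mk (FreeAbelianGroup.of M)

/-- A function on modules is additive if it is additive on short exact sequences. -/
def IsAdditive {X : Type*} [AddCommGroup X] {κ : ModKind} (f : KindMod κ B → X) : Prop :=
  ∀ (L M N : KindMod κ B) (i : L.1.carrier →ₗ[B] M.1.carrier)
    (p : M.1.carrier →ₗ[B] N.1.carrier), IsShortExact i p → f M = f L + f N

/-- The homomorphism on the Grothendieck group induced by an additive function. -/
noncomputable def Groth.lift {X : Type*} [AddCommGroup X] {κ : ModKind}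
    (f : KindMod κ B → X) (hf : IsAdditive f) : Groth κ B →ₗ[ℤ] X :=
  AddMonoidHom.toIntLinearMap <|
    QuotientAddGroup.lift (AddSubgroup.closure (sesRelations κ B)) (FreeAbelianGroup.lift f) (by
      rw [AddSubgroup.closure_le]
      rintro x ⟨L, M, N, i, p, h, rfl⟩
      simp [hf L M N i p h])

@[simp]
theorem Groth.lift_cls {X : Type*} [AddCommGroup X] {κ : ModKind}
    (f : KindMod κ B → X) (hf : IsAdditive f) (M : KindMod κ B) :
    Groth.lift f hf (Groth.cls M) = f M := by
  change FreeAbelianGroup.lift f (FreeAbelianGroup.of M) = f M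
  exact FreeAbelianGroup.lift_apply_of f M

theorem Groth.isAdditive_cls {κ : ModKind} : IsAdditive (Groth.cls : KindMod κ B → Groth κ B) := by
  intro L M N i p h
  have : QuotientAddGroup.mk (s := AddSubgroup.closure (sesRelations κ B))
      (FreeAbelianGroup.of M - FreeAbelianGroup.of L - FreeAbelianGroup.of N) = 0 :=
    (QuotientAddGroup.eq_zero_iff _).2 (AddSubgroup.subset_closure ⟨L, M, N, i, p, h, rfl⟩)
  have h2 : Groth.cls M - Groth.cls L - Groth.cls N = (0 : Groth κ B) := this
  rw [sub_sub, sub_eq_zero] at h2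
  exact h2

theorem Groth.hom_ext {X : Type*} [AddCommGroup X] {κ : ModKind} {f g : Groth κ B →ₗ[ℤ] X}
    (h : ∀ M, f (Groth.cls M) = g (Groth.cls M)) : f = g := by
  ext x
  obtain ⟨x, rfl⟩ := QuotientAddGroup.mk_surjective x
  have : f.toAddMonoidHom.comp (QuotientAddGroup.mk' (AddSubgroup.closure (sesRelations κ B)))
      = g.toAddMonoidHom.comp (QuotientAddGroup.mk' _) :=
    FreeAbelianGroup.lift_ext _ _ h
  exact DFunLike.congr_fun this x

/-- The bilinear map on Grothendieck groups induced by a biadditive function. -/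
noncomputable def Groth.lift₂ {C : Type u} [Ring C] [Algebra ℂ C] {X : Type*} [AddCommGroup X]
    {κ κ' : ModKind} (f : KindMod κ B → KindMod κ' C → X)
    (h₁ : ∀ N, IsAdditive fun M => f M N) (h₂ : ∀ M, IsAdditive (f M)) :
    Groth κ B →ₗ[ℤ] Groth κ' C →ₗ[ℤ] X :=
  Groth.lift (fun M => Groth.lift (f M) (h₂ M)) (by
    intro L M N i p h
    apply Groth.hom_ext
    intro Q
    simpa using h₁ Q L M N i p h)

@[simp]
theorem Groth.lift₂_cls {C : Type u} [Ring C] [Algebra ℂ C] {X : Type*} [AddCommGroup X]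
    {κ κ' : ModKind} (f : KindMod κ B → KindMod κ' C → X)
    (h₁ : ∀ N, IsAdditive fun M => f M N) (h₂ : ∀ M, IsAdditive (f M))
    (M : KindMod κ B) (N : KindMod κ' C) :
    Groth.lift₂ f h₁ h₂ (Groth.cls M) (Groth.cls N) = f M N := by
  have h := DFunLike.congr_fun (Groth.lift_cls (fun M => Groth.lift (f M) (h₂ M)) (by
    intro L M N i p h
    apply Groth.hom_ext
    intro Q
    simpa using h₁ Q L M N i p h) M) (Groth.cls N)
  exact h.trans (Groth.lift_cls (f M) (h₂ M) N)

end Modules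

/-! ### The external tensor product of modules -/

section Tensor

variable {A B : Type u} [Ring A] [Algebra ℂ A] [Ring B] [Algebra ℂ B]

/-- The `A ⊗ B`-module structure on `M ⊗ N`, `(a ⊗ b) • (m ⊗ n) = (a • m) ⊗ (b • n)`. -/
noncomputable abbrev tensorModule (A B M N : Type u) [Ring A] [Algebra ℂ A] [Ring B] [Algebra ℂ B]
    [AddCommGroup M] [Module ℂ M] [Module A M] [IsScalarTower ℂ A M]
    [AddCommGroup N] [Module ℂ N] [Module B N] [IsScalarTower ℂ B N] :
    Module (A ⊗[ℂ] B) (M ⊗[ℂ] N) :=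
  Module.compHom (M ⊗[ℂ] N)
    ((Module.endTensorEndAlgHom (R := ℂ) (S := ℂ) (A := ℂ) (M := M) (N := N)).comp
      (Algebra.TensorProduct.map (Algebra.lsmul ℂ ℂ M : A →ₐ[ℂ] Module.End ℂ M)
        (Algebra.lsmul ℂ ℂ N : B →ₐ[ℂ] Module.End ℂ N))).toRingHom

attribute [local instance] tensorModule

section

variable {M N : Type u}
  [AddCommGroup M] [Module ℂ M] [Module A M] [IsScalarTower ℂ A M]
  [AddCommGroup N] [Module ℂ N] [Module B N] [IsScalarTower ℂ B N]

theorem tmul_smul_tmul (a : A) (b : B) (m : M) (n : N) :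
    (a ⊗ₜ[ℂ] b) • (m ⊗ₜ[ℂ] n) = (a • m) ⊗ₜ[ℂ] (b • n) := rfl

theorem tensor_isScalarTower (A B M N : Type u) [Ring A] [Algebra ℂ A] [Ring B] [Algebra ℂ B]
    [AddCommGroup M] [Module ℂ M] [Module A M] [IsScalarTower ℂ A M]
    [AddCommGroup N] [Module ℂ N] [Module B N] [IsScalarTower ℂ B N] :
    IsScalarTower ℂ (A ⊗[ℂ] B) (M ⊗[ℂ] N) := by
  refine IsScalarTower.of_algebraMap_smul fun r x => ?_
  induction x with
  | zero => simp
  | add x y hx hy => rw [smul_add, smul_add, hx, hy]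
  | tmul m n =>
    rw [Algebra.TensorProduct.algebraMap_apply, tmul_smul_tmul, one_smul, algebraMap_smul,
      TensorProduct.smul_tmul']

/-- A complex-linear map is linear over `A ⊗ B` if it commutes with the pure tensors. -/
noncomputable def tensorLinear {M' : Type*} [AddCommGroup M'] [Module (A ⊗[ℂ] B) M']
    (f : M ⊗[ℂ] N →+ M')
    (hf : ∀ (a : A) (b : B) (m : M) (n : N),
      f ((a • m) ⊗ₜ[ℂ] (b • n)) = (a ⊗ₜ[ℂ] b) • f (m ⊗ₜ[ℂ] n)) :
    M ⊗[ℂ] N →ₗ[A ⊗[ℂ] B] M' where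
  toFun := f
  map_add' := f.map_add
  map_smul' t x := by
    induction t with
    | zero => simp
    | add s t hs ht => simp only [add_smul, map_add, hs, ht, RingHom.id_apply]
    | tmul a b =>
      induction x with
      | zero => simp
      | add x y hx hy => simp only [smul_add, map_add, hx, hy]
      | tmul m n => rw [tmul_smul_tmul, hf]; rfl

theorem tensor_finite [Module.Finite A M] [Module.Finite B N] :
    Module.Finite (A ⊗[ℂ] B) (M ⊗[ℂ] N) := by
  obtain ⟨s, hs⟩ := Module.Finite.fg_top (R := A) (M := M)
  obtain ⟨t, ht⟩ := Module.Finite.fg_top (R := B) (M := N)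
  classical
  refine ⟨⟨Finset.image₂ (fun m n => m ⊗ₜ[ℂ] n) s t, ?_⟩⟩
  rw [eq_top_iff]
  rintro x -
  set W := Submodule.span (A ⊗[ℂ] B) (↑(Finset.image₂ (fun m n => m ⊗ₜ[ℂ] n) s t) :
    Set (M ⊗[ℂ] N)) with hW
  induction x with
  | zero => exact W.zero_mem
  | add x y hx hy => exact W.add_mem hx hy
  | tmul m n =>
    have hm : m ∈ Submodule.span A (s : Set M) := hs ▸ Submodule.mem_top
    have hn : n ∈ Submodule.span B (t : Set N) := ht ▸ Submodule.mem_top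
    induction hm using Submodule.span_induction with
    | zero => rw [TensorProduct.zero_tmul]; exact W.zero_mem
    | add x y _ _ hx hy => rw [TensorProduct.add_tmul]; exact W.add_mem hx hy
    | smul a x _ hx =>
      have := W.smul_mem (a ⊗ₜ[ℂ] (1 : B)) hx
      rwa [tmul_smul_tmul, one_smul] at this
    | mem x hx =>
      induction hn using Submodule.span_induction with
      | zero => rw [TensorProduct.tmul_zero]; exact W.zero_mem
      | add y z _ _ hy hz => rw [TensorProduct.tmul_add]; exact W.add_mem hy hz
      | smul b y _ hy =>
        have := W.smul_mem ((1 : A) ⊗ₜ[ℂ] b) hy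
        rwa [tmul_smul_tmul, one_smul] at this
      | mem y hy =>
        exact Submodule.subset_span (by
          rw [Finset.coe_image₂]
          exact Set.mem_image2_of_mem hx hy)

theorem tensor_projective [Module.Projective A M] [Module.Projective B N] :
    Module.Projective (A ⊗[ℂ] B) (M ⊗[ℂ] N) := by
  obtain ⟨s, hs⟩ := (Module.projective_def (R := A) (P := M)).1 inferInstance
  obtain ⟨t, ht⟩ := (Module.projective_def (R := B) (P := N)).1 inferInstance
  let e := finsuppTensorFinsupp ℂ ℂ A B M N
  let i₀ : M ⊗[ℂ] N →ₗ[ℂ] (M × N →₀ A ⊗[ℂ] B) :=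
    e.toLinearMap ∘ₗ TensorProduct.map (s.restrictScalars ℂ) (t.restrictScalars ℂ)
  let i : M ⊗[ℂ] N →ₗ[A ⊗[ℂ] B] (M × N →₀ A ⊗[ℂ] B) :=
    tensorLinear i₀.toAddMonoidHom (by
      intro a b m n
      refine Finsupp.ext fun p => ?_
      obtain ⟨p, q⟩ := p
      simp [i₀, e, finsuppTensorFinsupp_apply])
  let q : (M × N →₀ A ⊗[ℂ] B) →ₗ[A ⊗[ℂ] B] M ⊗[ℂ] N :=
    Finsupp.linearCombination (A ⊗[ℂ] B) fun p : M × N => p.1 ⊗ₜ[ℂ] p.2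
  have key : ∀ (f : M →₀ A) (g : N →₀ B), q (e (f ⊗ₜ[ℂ] g)) =
      (Finsupp.linearCombination A id f) ⊗ₜ[ℂ] (Finsupp.linearCombination B id g) := by
    intro f g
    induction f using Finsupp.induction_linear with
    | zero => simp
    | add f f' hf hf' =>
      rw [TensorProduct.add_tmul, map_add, map_add, hf, hf', map_add, TensorProduct.add_tmul]
    | single m a =>
      induction g using Finsupp.induction_linear with
      | zero => simp
      | add g g' hg hg' =>
        rw [TensorProduct.tmul_add, map_add, map_add, hg, hg', map_add, TensorProduct.tmul_add]
      | single n b =>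
        simp [q, e, finsuppTensorFinsupp_single, tmul_smul_tmul]
  refine Module.Projective.of_split i q ?_
  refine LinearMap.ext fun x => ?_
  change q (i₀ x) = x
  induction x with
  | zero => simp
  | add x y hx hy => rw [map_add, map_add, hx, hy]
  | tmul m n =>
    change q (e (s m ⊗ₜ[ℂ] t n)) = _
    rw [key, hs m, ht n]

end

/-- The external tensor product `M ⊗ N` of an `A`-module and a `B`-module, as a module over
`A ⊗ B`. -/
noncomputable def FinMod.tensor (M : FinMod A) (N : FinMod B) : FinMod (A ⊗[ℂ] B) :=
  { carrier := M.carrier ⊗[ℂ] N.carrier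
    module := tensorModule A B M.carrier N.carrier
    isScalarTower := tensor_isScalarTower A B M.carrier N.carrier
    finite := tensor_finite }

theorem ModKind.mem_tensor (κ : ModKind) (M : FinMod A) (N : FinMod B) (hM : κ.Mem M)
    (hN : κ.Mem N) : κ.Mem (M.tensor N) := by
  cases κ
  · trivial
  · have : Module.Projective A M.carrier := hM
    have : Module.Projective B N.carrier := hN
    exact tensor_projective (A := A) (B := B) (M := M.carrier) (N := N.carrier)

/-- The external tensor product on objects of kind `κ`. -/
noncomputable def KindMod.tensor {κ : ModKind} (M : KindMod κ A) (N : KindMod κ B) :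
    KindMod κ (A ⊗[ℂ] B) :=
  ⟨M.1.tensor N.1, κ.mem_tensor M.1 N.1 M.2 N.2⟩

/-- The external product `[M] ⊗ [N] ↦ [M ⊗ N]` on Grothendieck groups. -/
noncomputable def extProd (κ : ModKind) (A B : Type u) [Ring A] [Algebra ℂ A] [Ring B]
    [Algebra ℂ B] : Groth κ A →ₗ[ℤ] Groth κ B →ₗ[ℤ] Groth κ (A ⊗[ℂ] B) :=
  Groth.lift₂ (fun M N => Groth.cls (M.tensor N))
    (by
      intro Q L M N f g ⟨hf, hfg, hg⟩
      refine Groth.isAdditive_cls (L.tensor Q) (M.tensor Q) (N.tensor Q)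
        (tensorLinear (M := L.1.carrier) (N := Q.1.carrier) (M' := M.1.carrier ⊗[ℂ] Q.1.carrier)
          ((f.restrictScalars ℂ).rTensor Q.1.carrier).toAddMonoidHom ?_)
        (tensorLinear (M := M.1.carrier) (N := Q.1.carrier) (M' := N.1.carrier ⊗[ℂ] Q.1.carrier)
          ((g.restrictScalars ℂ).rTensor Q.1.carrier).toAddMonoidHom ?_) ⟨?_, ?_, ?_⟩
      · intro a b m n
        simp only [LinearMap.toAddMonoidHom_coe, LinearMap.rTensor_tmul,
          LinearMap.coe_restrictScalars, map_smul]
        rfl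
      · intro a b m n
        simp only [LinearMap.toAddMonoidHom_coe, LinearMap.rTensor_tmul,
          LinearMap.coe_restrictScalars, map_smul]
        rfl
      · exact Module.Flat.rTensor_preserves_injective_linearMap (f.restrictScalars ℂ) hf
      · exact rTensor_exact Q.1.carrier (f := f.restrictScalars ℂ) (g := g.restrictScalars ℂ)
          hfg hg
      · exact LinearMap.rTensor_surjective Q.1.carrier (g := g.restrictScalars ℂ) hg)
    (by
      intro Q L M N f g ⟨hf, hfg, hg⟩
      refine Groth.isAdditive_cls (Q.tensor L) (Q.tensor M) (Q.tensor N)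
        (tensorLinear (M := Q.1.carrier) (N := L.1.carrier) (M' := Q.1.carrier ⊗[ℂ] M.1.carrier)
          ((f.restrictScalars ℂ).lTensor Q.1.carrier).toAddMonoidHom ?_)
        (tensorLinear (M := Q.1.carrier) (N := M.1.carrier) (M' := Q.1.carrier ⊗[ℂ] N.1.carrier)
          ((g.restrictScalars ℂ).lTensor Q.1.carrier).toAddMonoidHom ?_) ⟨?_, ?_, ?_⟩
      · intro a b m n
        simp only [LinearMap.toAddMonoidHom_coe, LinearMap.lTensor_tmul,
          LinearMap.coe_restrictScalars, map_smul]
        rfl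
      · intro a b m n
        simp only [LinearMap.toAddMonoidHom_coe, LinearMap.lTensor_tmul,
          LinearMap.coe_restrictScalars, map_smul]
        rfl
      · exact Module.Flat.lTensor_preserves_injective_linearMap (f.restrictScalars ℂ) hf
      · exact lTensor_exact Q.1.carrier (f := f.restrictScalars ℂ) (g := g.restrictScalars ℂ)
          hfg hg
      · exact LinearMap.lTensor_surjective Q.1.carrier (g := g.restrictScalars ℂ) hg)

end Tensor

/-! ### Restriction and induction along a homomorphism of algebras -/

section IndRes

variable {B C : Type u} [Ring B] [Algebra ℂ B] [Ring C] [Algebra ℂ C]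

/-- `C` is projective as a left `B`-module, `b` acting by left multiplication with `φ b`. -/
def LeftProjective (φ : B →ₐ[ℂ] C) : Prop :=
  @Module.Projective B _ C _ (Module.compHom C φ.toRingHom)

/-- `C` is projective as a right `B`-module (that is, as a left `Bᵐᵒᵖ`-module), `b` acting by right
multiplication with `φ b`. -/
def RightProjective (φ : B →ₐ[ℂ] C) : Prop :=
  @Module.Projective Bᵐᵒᵖ _ C _ (Module.compHom C (RingHom.op φ.toRingHom))

/-- The restriction along `φ`, with `b` acting as `φ b`. -/
def FinMod.res [Module.Finite ℂ C] (φ : B →ₐ[ℂ] C) (M : FinMod C) : FinMod B :=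
  letI : Module B M.carrier := Module.compHom M.carrier φ.toRingHom
  haveI : IsScalarTower ℂ B M.carrier := IsScalarTower.of_algebraMap_smul fun r x => by
    change φ (algebraMap ℂ B r) • x = r • x
    rw [AlgHom.commutes, algebraMap_smul]
  haveI : Module.Finite ℂ M.carrier := Module.Finite.trans C M.carrier
  { carrier := M.carrier
    finite := Module.Finite.of_restrictScalars_finite ℂ B M.carrier }

theorem ModKind.mem_res [Module.Finite ℂ C] (κ : ModKind) (φ : B →ₐ[ℂ] C)
    (hφ : LeftProjective φ) (M : FinMod C) (hM : κ.Mem M) : κ.Mem (M.res φ) := by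
  cases κ
  · trivial
  · have hM : Module.Projective C M.carrier := hM
    letI : Module B M.carrier := Module.compHom M.carrier φ.toRingHom
    letI : Module B C := Module.compHom C φ.toRingHom
    have : Module.Projective B C := hφ
    change Module.Projective B M.carrier
    classical
    obtain ⟨s, hs⟩ := (Module.projective_def (R := C) (P := M.carrier)).1 inferInstance
    have hsm : ∀ (b : B) (c : M.carrier →₀ C), b • c = φ b • c := fun b c => by
      ext x; rfl
    let s' : M.carrier →ₗ[B] (M.carrier →₀ C) :=
      { toFun := s
        map_add' := s.map_add
        map_smul' := fun b m => by
          rw [RingHom.id_apply, hsm, ← map_smul]; rfl }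
    let q' : (M.carrier →₀ C) →ₗ[B] M.carrier :=
      { toFun := Finsupp.linearCombination C id
        map_add' := map_add _
        map_smul' := fun b m => by
          rw [RingHom.id_apply, hsm, map_smul]; rfl }
    have : Module.Projective B (M.carrier →₀ C) :=
      Module.Projective.of_equiv (finsuppLequivDFinsupp B (ι := M.carrier) (M := C)).symm
    exact Module.Projective.of_split s' q' (LinearMap.ext hs)

/-- The restriction `[M] ↦ [Res M]` on Grothendieck groups. -/
noncomputable def resHom [Module.Finite ℂ C] (κ : ModKind) (φ : B →ₐ[ℂ] C)
    (hφ : LeftProjective φ) : Groth κ C →ₗ[ℤ] Groth κ B :=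
  Groth.lift (fun M => Groth.cls ⟨M.1.res φ, κ.mem_res φ hφ M.1 M.2⟩) (by
    intro L M N f g h
    refine Groth.isAdditive_cls ⟨L.1.res φ, κ.mem_res φ hφ L.1 L.2⟩
      ⟨M.1.res φ, κ.mem_res φ hφ M.1 M.2⟩ ⟨N.1.res φ, κ.mem_res φ hφ N.1 N.2⟩
      (show (L.1.res φ).carrier →ₗ[B] (M.1.res φ).carrier from
        { toFun := f, map_add' := f.map_add, map_smul' := fun b x => f.map_smul (φ b) x })
      (show (M.1.res φ).carrier →ₗ[B] (N.1.res φ).carrier from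
        { toFun := g, map_add' := g.map_add, map_smul' := fun b x => g.map_smul (φ b) x }) h)

/-- The relations `c φ(b) ⊗ x - c ⊗ b x` in `C ⊗ X`. -/
def indRelations (φ : B →ₐ[ℂ] C) (X : Type u) [AddCommGroup X] [Module ℂ X] [Module B X] :
    Submodule C (C ⊗[ℂ] X) :=
  Submodule.span C {t | ∃ (c : C) (b : B) (x : X), t = (c * φ b) ⊗ₜ[ℂ] x - c ⊗ₜ[ℂ] (b • x)}

/-- The induced module `C ⊗_φ X`: the left `C`-module `C ⊗ X` modulo the relations
`c φ(b) ⊗ x = c ⊗ b x`. -/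
abbrev Ind (φ : B →ₐ[ℂ] C) (X : Type u) [AddCommGroup X] [Module ℂ X] [Module B X] : Type u :=
  (C ⊗[ℂ] X) ⧸ indRelations φ X

namespace Ind

variable (φ : B →ₐ[ℂ] C) {X Y Z : Type u}
  [AddCommGroup X] [Module ℂ X] [Module B X] [IsScalarTower ℂ B X]
  [AddCommGroup Y] [Module ℂ Y] [Module B Y] [IsScalarTower ℂ B Y]
  [AddCommGroup Z] [Module ℂ Z] [Module B Z] [IsScalarTower ℂ B Z]

theorem isScalarTower : IsScalarTower ℂ C (Ind φ X) := inferInstance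

theorem mk_smul (c : C) (b : B) (x : X) :
    (indRelations φ X).mkQ ((c * φ b) ⊗ₜ[ℂ] x) = (indRelations φ X).mkQ (c ⊗ₜ[ℂ] (b • x)) := by
  rw [← sub_eq_zero, ← map_sub, Submodule.mkQ_apply, Submodule.Quotient.mk_eq_zero]
  exact Submodule.subset_span ⟨c, b, x, rfl⟩

theorem finite [Module.Finite B X] : Module.Finite C (Ind φ X) := by
  obtain ⟨s, hs⟩ := Module.Finite.fg_top (R := B) (M := X)
  classical
  refine ⟨⟨s.image fun x => (indRelations φ X).mkQ ((1 : C) ⊗ₜ[ℂ] x), ?_⟩⟩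
  rw [eq_top_iff]
  rintro y -
  obtain ⟨t, rfl⟩ := (indRelations φ X).mkQ_surjective y
  set W := Submodule.span C
    (↑(s.image fun x => (indRelations φ X).mkQ ((1 : C) ⊗ₜ[ℂ] x)) : Set (Ind φ X)) with hW
  induction t with
  | zero => rw [map_zero]; exact W.zero_mem
  | add x y hx hy => rw [map_add]; exact W.add_mem hx hy
  | tmul c x =>
    have hx : x ∈ Submodule.span B (s : Set X) := hs ▸ Submodule.mem_top
    induction hx using Submodule.span_induction generalizing c with
    | zero => rw [TensorProduct.tmul_zero, map_zero]; exact W.zero_mem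
    | add x y _ _ hx hy => rw [TensorProduct.tmul_add, map_add]; exact W.add_mem (hx c) (hy c)
    | smul b x _ hx => rw [← mk_smul]; exact hx (c * φ b)
    | mem x hx =>
      have h : (indRelations φ X).mkQ (c ⊗ₜ[ℂ] x)
          = c • (indRelations φ X).mkQ ((1 : C) ⊗ₜ[ℂ] x) := by
        rw [← map_smul, TensorProduct.smul_tmul', smul_eq_mul, mul_one]
      rw [h]
      exact W.smul_mem _ (Submodule.subset_span (Finset.mem_coe.2 (Finset.mem_image_of_mem _ hx)))

/-- The universal property of induction. -/
noncomputable def lift {W : Type u} [AddCommGroup W] [Module ℂ W] [Module C W]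
    [IsScalarTower ℂ C W] (f : X →ₗ[ℂ] W) (hf : ∀ (b : B) (x : X), f (b • x) = φ b • f x) :
    Ind φ X →ₗ[C] W :=
  (indRelations φ X).liftQ
    (TensorProduct.AlgebraTensorModule.lift (LinearMap.toSpanSingleton C (X →ₗ[ℂ] W) f)) (by
      rw [indRelations, Submodule.span_le]
      rintro _ ⟨c, b, x, rfl⟩
      simp [hf, mul_smul])

theorem lift_mk {W : Type u} [AddCommGroup W] [Module ℂ W] [Module C W]
    [IsScalarTower ℂ C W] (f : X →ₗ[ℂ] W) (hf : ∀ (b : B) (x : X), f (b • x) = φ b • f x)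
    (c : C) (x : X) : lift φ f hf ((indRelations φ X).mkQ (c ⊗ₜ[ℂ] x)) = c • f x := by
  simp [lift]

theorem hom_ext {W : Type u} [AddCommGroup W] [Module C W] {f g : Ind φ X →ₗ[C] W}
    (h : ∀ x, f ((indRelations φ X).mkQ ((1 : C) ⊗ₜ[ℂ] x))
      = g ((indRelations φ X).mkQ ((1 : C) ⊗ₜ[ℂ] x))) : f = g := by
  refine LinearMap.ext fun y => ?_
  obtain ⟨t, rfl⟩ := (indRelations φ X).mkQ_surjective y
  induction t with
  | zero => simp
  | add x y hx hy => simp only [map_add, hx, hy]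
  | tmul c x =>
    have e : (indRelations φ X).mkQ (c ⊗ₜ[ℂ] x)
        = c • (indRelations φ X).mkQ ((1 : C) ⊗ₜ[ℂ] x) := by
      rw [← map_smul, TensorProduct.smul_tmul', smul_eq_mul, mul_one]
    rw [e, map_smul, map_smul, h]

theorem projective [Module.Projective B X] : Module.Projective C (Ind φ X) := by
  refine Module.Projective.of_lifting_property ?_
  intro V W _ _ _ _ f g hf
  letI : Module ℂ V := Module.restrictScalars ℂ C V
  letI : Module ℂ W := Module.restrictScalars ℂ C W
  haveI : IsScalarTower ℂ C V := IsScalarTower.restrictScalars ℂ C V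
  haveI : IsScalarTower ℂ C W := IsScalarTower.restrictScalars ℂ C W
  letI : Module B V := Module.compHom V φ.toRingHom
  letI : Module B W := Module.compHom W φ.toRingHom
  haveI : IsScalarTower ℂ B V := IsScalarTower.of_algebraMap_smul fun r x => by
    change φ (algebraMap ℂ B r) • x = r • x
    rw [AlgHom.commutes, algebraMap_smul]
  let f' : V →ₗ[B] W :=
    { toFun := f, map_add' := f.map_add, map_smul' := fun b x => f.map_smul (φ b) x }
  let g' : X →ₗ[B] W :=
    { toFun := fun x => g ((indRelations φ X).mkQ ((1 : C) ⊗ₜ[ℂ] x))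
      map_add' := fun x y => by rw [TensorProduct.tmul_add, map_add, map_add]
      map_smul' := fun b x => by
        rw [← mk_smul, one_mul, RingHom.id_apply]
        change _ = φ b • g _
        rw [← map_smul, ← map_smul, TensorProduct.smul_tmul', smul_eq_mul, mul_one] }
  obtain ⟨k, hk⟩ := Module.projective_lifting_property f' g' hf
  have hk' : ∀ (b : B) (x : X), (k.restrictScalars ℂ) (b • x) = φ b • (k.restrictScalars ℂ) x :=
    fun b x => k.map_smul b x
  refine ⟨lift φ (k.restrictScalars ℂ) hk', hom_ext φ fun x => ?_⟩
  have h1 := congrArg f (lift_mk φ (k.restrictScalars ℂ) hk' 1 x)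
  rw [one_smul] at h1
  exact h1.trans (LinearMap.congr_fun hk x)

/-- Functoriality of induction. -/
noncomputable def map (f : X →ₗ[B] Y) : Ind φ X →ₗ[C] Ind φ Y :=
  (indRelations φ X).mapQ (indRelations φ Y)
    (TensorProduct.AlgebraTensorModule.lTensor C C (f.restrictScalars ℂ)) (by
      rw [indRelations, Submodule.span_le]
      rintro _ ⟨c, b, x, rfl⟩
      refine Submodule.subset_span ⟨c, b, f x, ?_⟩
      simp)

theorem map_mk (f : X →ₗ[B] Y) (c : C) (x : X) :
    map φ f ((indRelations φ X).mkQ (c ⊗ₜ[ℂ] x)) = (indRelations φ Y).mkQ (c ⊗ₜ[ℂ] f x) := by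
  simp [map]

theorem map_mk' (f : X →ₗ[B] Y) (t : C ⊗[ℂ] X) :
    map φ f ((indRelations φ X).mkQ t)
      = (indRelations φ Y).mkQ ((f.restrictScalars ℂ).lTensor C t) := rfl

theorem map_surjective (f : X →ₗ[B] Y) (hf : Function.Surjective f) :
    Function.Surjective (map φ f) := by
  intro y
  obtain ⟨t, rfl⟩ := (indRelations φ Y).mkQ_surjective y
  obtain ⟨t, rfl⟩ := LinearMap.lTensor_surjective C (g := f.restrictScalars ℂ) hf t
  exact ⟨_, map_mk' φ f t⟩

theorem map_exact (f : X →ₗ[B] Y) (g : Y →ₗ[B] Z) (hfg : Function.Exact f g)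
    (hg : Function.Surjective g) : Function.Exact (map φ f) (map φ g) := by
  intro y
  constructor
  · intro hy
    obtain ⟨t, rfl⟩ := (indRelations φ Y).mkQ_surjective y
    rw [map_mk', Submodule.mkQ_apply, Submodule.Quotient.mk_eq_zero] at hy
    have hle : indRelations φ Z ≤ (indRelations φ Y).map
        (TensorProduct.AlgebraTensorModule.lTensor C C (g.restrictScalars ℂ)) := by
      rw [indRelations, Submodule.span_le]
      rintro _ ⟨c, b, z, rfl⟩
      obtain ⟨y, rfl⟩ := hg z
      exact ⟨(c * φ b) ⊗ₜ[ℂ] y - c ⊗ₜ[ℂ] (b • y), Submodule.subset_span ⟨c, b, y, rfl⟩, by simp⟩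
    obtain ⟨r, hr, hrt⟩ := hle hy
    have h0 : (g.restrictScalars ℂ).lTensor C (t - r) = 0 := by
      rw [map_sub, sub_eq_zero]; exact hrt.symm
    obtain ⟨w, hw⟩ := (lTensor_exact C (f := f.restrictScalars ℂ) (g := g.restrictScalars ℂ)
      hfg hg (t - r)).1 h0
    refine ⟨(indRelations φ X).mkQ w, ?_⟩
    rw [map_mk', hw, map_sub, sub_eq_self, Submodule.mkQ_apply, Submodule.Quotient.mk_eq_zero]
    exact hr
  · rintro ⟨x, rfl⟩
    obtain ⟨t, rfl⟩ := (indRelations φ X).mkQ_surjective x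
    rw [map_mk', map_mk', (lTensor_exact C (f := f.restrictScalars ℂ) (g := g.restrictScalars ℂ)
      hfg hg _).2 ⟨t, rfl⟩, map_zero]

theorem map_injective (hφ : RightProjective φ) (f : X →ₗ[B] Y) (hf : Function.Injective f) :
    Function.Injective (map φ f) := by
  letI : Module Bᵐᵒᵖ C := Module.compHom C (RingHom.op φ.toRingHom)
  have hop : ∀ (b : Bᵐᵒᵖ) (c : C), b • c = c * φ b.unop := fun _ _ => rfl
  haveI : Module.Projective Bᵐᵒᵖ C := hφ
  obtain ⟨s, hs⟩ := (Module.projective_def (R := Bᵐᵒᵖ) (P := C)).1 inferInstance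
  -- the additive map `c ⊗ x ↦ (d ↦ (s c d) x)`
  let ev : ∀ (V : Type u) [AddCommGroup V] [Module B V], (C →₀ Bᵐᵒᵖ) →+ V →+ (C →₀ V) :=
    fun V _ _ =>
    { toFun := fun r =>
        { toFun := fun x => r.mapRange (fun b => b.unop • x) (by simp)
          map_zero' := by ext; simp
          map_add' := fun x y => by ext; simp }
      map_zero' := by ext; simp
      map_add' := fun r r' => by
        ext x d
        simp [add_smul] }
  have hev : ∀ (V : Type u) [AddCommGroup V] [Module B V] (r : C →₀ Bᵐᵒᵖ) (x : V) (d : C),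
      ev V r x d = (r d).unop • x := fun V _ _ r x d => by simp [ev]
  have hsb : ∀ (c : C) (b : B) (d : C), s (c * φ b) d = MulOpposite.op b * s c d := by
    intro c b d
    have : c * φ b = MulOpposite.op b • c := rfl
    rw [this, map_smul]; rfl
  let J : ∀ (V : Type u) [AddCommGroup V] [Module ℂ V] [Module B V] [IsScalarTower ℂ B V],
      C ⊗[ℂ] V →+ (C →₀ V) := fun V _ _ _ _ =>
    TensorProduct.liftAddHom ((ev V).comp s.toAddMonoidHom) (by
      intro z c v
      ext d
      have hz : z • c = c * φ (algebraMap ℂ B z) := by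
        rw [AlgHom.commutes, ← Algebra.commutes, ← Algebra.smul_def]
      change ev V (s (z • c)) v d = ev V (s c) (z • v) d
      rw [hev, hev, hz, hsb, MulOpposite.unop_mul, MulOpposite.unop_op, mul_smul,
        algebraMap_smul])
  have hJ : ∀ (V : Type u) [AddCommGroup V] [Module ℂ V] [Module B V] [IsScalarTower ℂ B V]
      (c : C) (v : V) (d : C), J V (c ⊗ₜ[ℂ] v) d = (s c d).unop • v :=
    fun V _ _ _ _ c v d => hev V (s c) v d
  have hJrel : ∀ t ∈ indRelations φ Y, J Y t = 0 := by
    intro t ht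
    suffices ∀ c : C, J Y (c • t) = 0 by simpa using this 1
    rw [indRelations] at ht
    induction ht using Submodule.span_induction with
    | zero => intro c; simp
    | add x y _ _ hx hy => intro c; rw [smul_add, map_add, hx, hy, add_zero]
    | smul a x _ hx => intro c; rw [← mul_smul]; exact hx _
    | mem x hx =>
      obtain ⟨a, b, y, rfl⟩ := hx
      intro c
      rw [smul_sub, TensorProduct.smul_tmul', TensorProduct.smul_tmul', map_sub, sub_eq_zero]
      ext d
      rw [hJ, hJ, smul_eq_mul, smul_eq_mul, ← mul_assoc, hsb, MulOpposite.unop_mul,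
        MulOpposite.unop_op, mul_smul]
  -- the additive map `d ↦ x` to `d ⊗ x`
  let R : (C →₀ X) →+ Ind φ X :=
    Finsupp.liftAddHom fun d =>
      ((indRelations φ X).mkQ.toAddMonoidHom.comp (TensorProduct.mk ℂ C X d).toAddMonoidHom)
  have hRs : ∀ (r : C →₀ Bᵐᵒᵖ) (x : X), R (ev X r x)
      = (indRelations φ X).mkQ ((Finsupp.linearCombination Bᵐᵒᵖ id r) ⊗ₜ[ℂ] x) := by
    intro r x
    induction r using Finsupp.induction_linear with
    | zero => simp
    | add r r' h h' =>
      rw [map_add, AddMonoidHom.add_apply, map_add, h, h', map_add, TensorProduct.add_tmul,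
        map_add]
    | single d b =>
      have : ev X (Finsupp.single d b) x = Finsupp.single d (b.unop • x) := by
        simp [ev]
      rw [this, Finsupp.linearCombination_single, id, hop, mk_smul]
      simp [R]
  have hRJ : ∀ t : C ⊗[ℂ] X, R (J X t) = (indRelations φ X).mkQ t := by
    intro t
    induction t with
    | zero => simp
    | add x y hx hy => rw [map_add, map_add, map_add, hx, hy]
    | tmul c x =>
      have : J X (c ⊗ₜ[ℂ] x) = ev X (s c) x := rfl
      rw [this, hRs, hs c]
  have hnat : ∀ (t : C ⊗[ℂ] X) (d : C),
      J Y ((f.restrictScalars ℂ).lTensor C t) d = f (J X t d) := by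
    intro t d
    induction t with
    | zero => simp
    | add x y hx hy => rw [map_add, map_add, map_add, Finsupp.add_apply, Finsupp.add_apply,
        map_add, hx, hy]
    | tmul c x =>
      rw [LinearMap.lTensor_tmul, hJ, hJ, LinearMap.coe_restrictScalars, map_smul]
  rw [injective_iff_map_eq_zero]
  intro y hy
  obtain ⟨t, rfl⟩ := (indRelations φ X).mkQ_surjective y
  rw [map_mk', Submodule.mkQ_apply, Submodule.Quotient.mk_eq_zero] at hy
  have h0 : J X t = 0 := by
    ext d
    apply hf
    rw [← hnat, hJrel _ hy]
    simp
  rw [← hRJ, h0, map_zero]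

end Ind

/-- The induced module, as a finitely generated `C`-module. -/
noncomputable def FinMod.ind (φ : B →ₐ[ℂ] C) (M : FinMod B) : FinMod C :=
  { carrier := Ind φ M.carrier
    finite := Ind.finite φ }

theorem ModKind.mem_ind (κ : ModKind) (φ : B →ₐ[ℂ] C) (M : FinMod B) (hM : κ.Mem M) :
    κ.Mem (M.ind φ) := by
  cases κ
  · trivial
  · have : Module.Projective B M.carrier := hM
    exact Ind.projective φ

/-- The induction `[M] ↦ [Ind M]` on Grothendieck groups. -/
noncomputable def indHom (κ : ModKind) (φ : B →ₐ[ℂ] C) (hφ : RightProjective φ) :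
    Groth κ B →ₗ[ℤ] Groth κ C :=
  Groth.lift (fun M => Groth.cls ⟨M.1.ind φ, κ.mem_ind φ M.1 M.2⟩) (by
    intro L M N f g ⟨hf, hfg, hg⟩
    exact Groth.isAdditive_cls ⟨L.1.ind φ, κ.mem_ind φ L.1 L.2⟩
      ⟨M.1.ind φ, κ.mem_ind φ M.1 M.2⟩ ⟨N.1.ind φ, κ.mem_ind φ N.1 N.2⟩
      (Ind.map φ f) (Ind.map φ g)
      ⟨Ind.map_injective φ hφ f hf, Ind.map_exact φ f g hfg hg, Ind.map_surjective φ g hg⟩)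

end IndRes

/-! ### Dimension and the pairing -/

section Pairing

theorem finrank_of_shortExact {U V W : Type*} [AddCommGroup U] [Module ℂ U]
    [AddCommGroup V] [Module ℂ V] [AddCommGroup W] [Module ℂ W] [Module.Finite ℂ V]
    (f : U →ₗ[ℂ] V) (g : V →ₗ[ℂ] W) (hf : Function.Injective f) (hfg : Function.Exact f g)
    (hg : Function.Surjective g) :
    Module.finrank ℂ V = Module.finrank ℂ U + Module.finrank ℂ W := by
  have h := LinearMap.finrank_range_add_finrank_ker g
  rw [LinearMap.exact_iff.1 hfg, LinearMap.finrank_range_of_inj hf,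
    LinearMap.range_eq_top.2 hg, finrank_top] at h
  omega

variable (B : Type u) [Ring B] [Algebra ℂ B] [Module.Finite ℂ B]

theorem FinMod.finite_complex {B : Type u} [Ring B] [Algebra ℂ B] [Module.Finite ℂ B]
    (M : FinMod B) : Module.Finite ℂ M.carrier :=
  Module.Finite.trans B M.carrier

/-- The dimension homomorphism `[M] ↦ dim M`. -/
noncomputable def dimHom (κ : ModKind) : Groth κ B →ₗ[ℤ] ℤ :=
  Groth.lift (fun M => (Module.finrank ℂ M.1.carrier : ℤ)) (by
    intro L M N f g ⟨hf, hfg, hg⟩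
    haveI := M.1.finite_complex
    have := finrank_of_shortExact (f.restrictScalars ℂ) (g.restrictScalars ℂ) hf hfg hg
    simp only [this]
    push_cast
    ring)

theorem finite_hom {B : Type u} [Ring B] [Algebra ℂ B] [Module.Finite ℂ B] (P M : FinMod B) :
    Module.Finite ℂ (P.carrier →ₗ[B] M.carrier) := by
  haveI := P.finite_complex
  haveI := M.finite_complex
  exact Module.Finite.of_injective
    (LinearMap.restrictScalarsₗ ℂ B P.carrier M.carrier ℂ)
    (LinearMap.restrictScalars_injective ℂ)

/-- The pairing `⟨[P], [M]⟩ = dim Hom_B(P, M)` between `K₀(B)` and `G₀(B)`. -/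
noncomputable def homPairing : Groth .projective B →ₗ[ℤ] Groth .all B →ₗ[ℤ] ℤ :=
  Groth.lift₂ (fun P M => (Module.finrank ℂ (P.1.carrier →ₗ[B] M.1.carrier) : ℤ))
    (by
      intro Q L M N f g ⟨hf, hfg, hg⟩
      haveI := finite_hom M.1 Q.1
      haveI : Module.Projective B N.1.carrier := N.2
      obtain ⟨s, hs⟩ := Module.projective_lifting_property g LinearMap.id hg
      have hs' : ∀ x, g (s x) = x := LinearMap.congr_fun hs
      have hgf : ∀ x, g (f x) = 0 := fun x => (hfg (f x)).2 ⟨x, rfl⟩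
      have := finrank_of_shortExact
        (LinearMap.lcomp ℂ Q.1.carrier g) (LinearMap.lcomp ℂ Q.1.carrier f) ?_ ?_ ?_
      · simp only [this]
        push_cast
        ring
      · intro a b hab
        refine LinearMap.ext fun x => ?_
        obtain ⟨y, rfl⟩ := hg x
        exact LinearMap.congr_fun hab y
      · intro a
        constructor
        · intro ha
          have ha' : ∀ x, a (f x) = 0 := LinearMap.congr_fun ha
          refine ⟨a ∘ₗ s, LinearMap.ext fun x => ?_⟩
          change a (s (g x)) = a x
          obtain ⟨y, hy⟩ := (hfg (x - s (g x))).1 (by rw [map_sub, hs', sub_self])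
          have := ha' y
          rw [hy, map_sub, sub_eq_zero] at this
          exact this.symm
        · rintro ⟨b, rfl⟩
          refine LinearMap.ext fun x => ?_
          change b (g (f x)) = 0
          rw [hgf, map_zero]
      · intro a
        -- the retraction of `f` determined by the section `s`
        have hex : ∀ x, ∃ y, f y = x - s (g x) := fun x =>
          (hfg (x - s (g x))).1 (by rw [map_sub, hs', sub_self])
        choose r hr using hex
        refine ⟨a ∘ₗ { toFun := r
                       map_add' := fun x y => hf (by
                        rw [map_add, hr, hr, hr, map_add, map_add]; abel)
                       map_smul' := fun c x => hf (by
                        rw [RingHom.id_apply, map_smul, hr, hr, map_smul, map_smul, smul_sub]) },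
          LinearMap.ext fun x => ?_⟩
        change a (r (f x)) = a x
        congr 1
        apply hf
        rw [hr, hgf, map_zero, sub_zero])
    (by
      intro P L M N f g ⟨hf, hfg, hg⟩
      haveI := finite_hom P.1 M.1
      haveI : Module.Projective B P.1.carrier := P.2
      let F : (P.1.carrier →ₗ[B] L.1.carrier) →ₗ[ℂ] (P.1.carrier →ₗ[B] M.1.carrier) :=
        { toFun := fun a => f ∘ₗ a
          map_add' := fun a b => LinearMap.comp_add _ _ _
          map_smul' := fun z a => LinearMap.ext fun x =>
            (f.restrictScalars ℂ).map_smul z (a x) }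
      let G : (P.1.carrier →ₗ[B] M.1.carrier) →ₗ[ℂ] (P.1.carrier →ₗ[B] N.1.carrier) :=
        { toFun := fun a => g ∘ₗ a
          map_add' := fun a b => LinearMap.comp_add _ _ _
          map_smul' := fun z a => LinearMap.ext fun x =>
            (g.restrictScalars ℂ).map_smul z (a x) }
      have := finrank_of_shortExact F G ?_ ?_ ?_
      · simp only [this]
        push_cast
        ring
      · intro a b hab
        exact LinearMap.ext fun x => hf (LinearMap.congr_fun hab x)
      · intro a
        constructor
        · intro ha
          have hex : ∀ x, ∃ y, f y = a x := fun x => (hfg (a x)).1 (LinearMap.congr_fun ha x)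
          choose r hr using hex
          refine ⟨{ toFun := r
                    map_add' := fun x y => hf (by rw [map_add, hr, hr, hr, map_add])
                    map_smul' := fun c x => hf (by
                      rw [RingHom.id_apply, map_smul, hr, hr, map_smul]) },
            LinearMap.ext fun x => hr x⟩
        · rintro ⟨b, rfl⟩
          exact LinearMap.ext fun x => (hfg (f (b x))).2 ⟨b x, rfl⟩
      · intro a
        exact Module.projective_lifting_property g a hg)

end Pairing

/-! ### Towers of algebras -/

/-- A tower of algebras over `ℂ`: a graded algebra `⨁ Aₙ` with external multiplication `ρ` such
that each `Aₙ` is in addition a finite-dimensional unital algebra by itself, `A₀ ≅ ℂ`, the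
multiplications `Aₖ ⊗ Aₗ → Aₖ₊ₗ` are injective unital homomorphisms of algebras, and `Aₖ₊ₗ` is
projective over `Aₖ ⊗ Aₗ` both as a left module and as a right module.

The target of `ρ k l n h` is `Aₙ` with `h : k + l = n`; this spares all transports between
`A ((k + l) + m)` and `A (k + (l + m))`. -/
structure Tower where
  A : ℕ → Type u
  [ring : ∀ n, Ring (A n)]
  [algebra : ∀ n, Algebra ℂ (A n)]
  [finite : ∀ n, Module.Finite ℂ (A n)]
  zero_equiv : Nonempty (A 0 ≃ₐ[ℂ] ℂ)
  ρ : ∀ k l n : ℕ, k + l = n → (A k ⊗[ℂ] A l →ₐ[ℂ] A n)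
  one_ρ : ∀ (n : ℕ) (a : A n), ρ 0 n n (Nat.zero_add n) (1 ⊗ₜ[ℂ] a) = a
  ρ_one : ∀ (n : ℕ) (a : A n), ρ n 0 n (Nat.add_zero n) (a ⊗ₜ[ℂ] 1) = a
  ρ_assoc : ∀ (k l m kl lm n : ℕ) (hkl : k + l = kl) (hlm : l + m = lm) (h : kl + m = n)
    (h' : k + lm = n) (a : A k) (b : A l) (c : A m),
    ρ kl m n h (ρ k l kl hkl (a ⊗ₜ[ℂ] b) ⊗ₜ[ℂ] c) = ρ k lm n h' (a ⊗ₜ[ℂ] ρ l m lm hlm (b ⊗ₜ[ℂ] c))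
  ρ_injective : ∀ (k l n : ℕ) (h : k + l = n), Function.Injective (ρ k l n h)
  left_projective : ∀ (k l n : ℕ) (h : k + l = n), LeftProjective (ρ k l n h)
  right_projective : ∀ (k l n : ℕ) (h : k + l = n), RightProjective (ρ k l n h)

attribute [instance] Tower.ring Tower.algebra Tower.finite

/-- The decomposition `G₀(A ⊗ B) ≅ G₀(A) ⊗ G₀(B)` (and likewise for `K₀`), the inverse of the
external product `[M] ⊗ [N] ↦ [M ⊗ N]`. For finite-dimensional algebras over the algebraically
closed field `ℂ`, the only ones for which it is used, the external product is bijective, because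
the simple `A ⊗ B`-modules are the tensor products of the simple modules of `A` and `B`, and
likewise for the indecomposable projective modules. -/
noncomputable def extProdInv (κ : ModKind) (A B : Type u) [Ring A] [Algebra ℂ A] [Ring B]
    [Algebra ℂ B] : Groth κ (A ⊗[ℂ] B) →ₗ[ℤ] Groth κ A ⊗[ℤ] Groth κ B :=
  open Classical in
  if h : Function.Bijective (TensorProduct.lift (extProd κ A B)) then
    (LinearEquiv.ofBijective (TensorProduct.lift (extProd κ A B)) h).symm.toLinearMap
  else 0

namespace Tower

variable (T : Tower.{u})

/-- `G(A) = ⨁ G₀(Aₙ)` for `κ = .all` and `K(A) = ⨁ K₀(Aₙ)` for `κ = .projective`. -/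
abbrev H (κ : ModKind) : Type (u + 1) := ⨁ n, Groth κ (T.A n)

variable (κ : ModKind)

/-- The multiplication `[M] [N] = [Ind (M ⊗ N)]`, on homogeneous components. -/
noncomputable def mulComp (k l : ℕ) :
    Groth κ (T.A k) →ₗ[ℤ] Groth κ (T.A l) →ₗ[ℤ] Groth κ (T.A (k + l)) :=
  (extProd κ (T.A k) (T.A l)).compr₂
    (indHom κ (T.ρ k l (k + l) rfl) (T.right_projective k l (k + l) rfl))

/-- The multiplication of `G(A)` and of `K(A)`. -/
noncomputable def mul : T.H κ →ₗ[ℤ] T.H κ →ₗ[ℤ] T.H κ :=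
  DirectSum.toModule ℤ ℕ _ fun k => LinearMap.flip <| DirectSum.toModule ℤ ℕ _ fun l =>
    LinearMap.flip <| (T.mulComp κ k l).compr₂
      (DirectSum.lof ℤ ℕ (fun n => Groth κ (T.A n)) (k + l))

/-- The unit: the class of `A₀ ≅ ℂ`, as a module over itself, in degree `0`. -/
noncomputable def one : T.H κ :=
  DirectSum.lof ℤ ℕ (fun n => Groth κ (T.A n)) 0
    (Groth.cls ⟨FinMod.regular (T.A 0), κ.mem_regular⟩)

/-- The `(k, l)` component `[N] ↦ [Res N] ∈ 𝒦₀(Aₖ ⊗ Aₗ) = 𝒦₀(Aₖ) ⊗ 𝒦₀(Aₗ)` of the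
comultiplication in degree `n = k + l`. -/
noncomputable def comulComp (k l n : ℕ) (h : k + l = n) :
    Groth κ (T.A n) →ₗ[ℤ] Groth κ (T.A k) ⊗[ℤ] Groth κ (T.A l) :=
  extProdInv κ (T.A k) (T.A l) ∘ₗ resHom κ (T.ρ k l n h) (T.left_projective k l n h)

/-- The comultiplication `Δ[N] = ∑_{k + l = n} [Res N]` of `G(A)` and of `K(A)`. -/
noncomputable def comul : T.H κ →ₗ[ℤ] T.H κ ⊗[ℤ] T.H κ :=
  DirectSum.toModule ℤ ℕ _ fun n => ∑ p ∈ (Finset.HasAntidiagonal.antidiagonal n).attach,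
    TensorProduct.map (DirectSum.lof ℤ ℕ (fun n => Groth κ (T.A n)) p.1.1)
        (DirectSum.lof ℤ ℕ (fun n => Groth κ (T.A n)) p.1.2) ∘ₗ
      T.comulComp κ p.1.1 p.1.2 n (Finset.HasAntidiagonal.mem_antidiagonal.1 p.2)

/-- The counit: `[M] ↦ dim M` in degree `0`, and `0` in positive degrees. -/
noncomputable def counit : T.H κ →ₗ[ℤ] ℤ :=
  dimHom (T.A 0) κ ∘ₗ DirectSum.component ℤ ℕ (fun n => Groth κ (T.A n)) 0

/-- The pairing `K(A) × G(A) → ℤ`: `⟨[P], [M]⟩ = dim Hom(P, M)` if `P` and `M` are modules over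
the same `Aₙ`, and `0` for different degrees. -/
noncomputable def pairing : T.H .projective →ₗ[ℤ] T.H .all →ₗ[ℤ] ℤ :=
  DirectSum.toModule ℤ ℕ _ fun n =>
    (homPairing (T.A n)).compl₂ (DirectSum.component ℤ ℕ (fun n => Groth .all (T.A n)) n)

/-- The induced pairing `⟨x ⊗ y, z ⊗ w⟩ = ⟨x, z⟩ ⟨y, w⟩` of `K(A) ⊗ K(A)` and `G(A) ⊗ G(A)`. -/
noncomputable def pairing₂ :
    T.H .projective ⊗[ℤ] T.H .projective →ₗ[ℤ] T.H .all ⊗[ℤ] T.H .all →ₗ[ℤ] ℤ :=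
  (TensorProduct.map₂ T.pairing T.pairing).compr₂ (LinearMap.mul' ℤ ℤ)

end Tower

/-- The given multiplication, unit, comultiplication and counit make the `k`-module `H` a Hopf
algebra over `k`: they are the operations of a Hopf algebra `R` with the same underlying module. -/
def FormsHopfAlgebra {k : Type} [CommRing k] {H : Type u} [AddCommGroup H] [Module k H]
    (mul : H →ₗ[k] H →ₗ[k] H) (one : H) (comul : H →ₗ[k] H ⊗[k] H) (counit : H →ₗ[k] k) : Prop :=
  ∃ (R : Type u) (_ : Ring R) (_ : HopfAlgebra k R) (e : R ≃ₗ[k] H),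
    (∀ x y, e (x * y) = mul (e x) (e y)) ∧ e 1 = one ∧
    (∀ x, TensorProduct.map e.toLinearMap e.toLinearMap (Coalgebra.comul (R := k) x)
      = comul (e x)) ∧
    ∀ x, Coalgebra.counit (R := k) x = counit (e x)

/-- The Grothendieck groups `K(A)` and `G(A)` of a tower form a pair of graded dual Hopf algebras:
induction and restriction make each of them a Hopf algebra over `ℤ` (the operations are graded by
construction), and the pairing is perfect in each degree and makes multiplication and
comultiplication, unit and counit adjoint to one another. -/
structure Tower.FormsDualHopfAlgebras (T : Tower.{u}) : Prop where
  hopf : ∀ κ, FormsHopfAlgebra (T.mul κ) (T.one κ) (T.comul κ) (T.counit κ)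
  perfect : ∀ n, (homPairing (T.A n)).IsPerfPair
  mul_left : ∀ (x y : T.H .projective) (z : T.H .all),
    T.pairing (T.mul .projective x y) z = T.pairing₂ (x ⊗ₜ[ℤ] y) (T.comul .all z)
  mul_right : ∀ (x : T.H .projective) (z w : T.H .all),
    T.pairing x (T.mul .all z w) = T.pairing₂ (T.comul .projective x) (z ⊗ₜ[ℤ] w)
  one_left : ∀ z : T.H .all, T.pairing (T.one .projective) z = T.counit .all z
  one_right : ∀ x : T.H .projective, T.pairing x (T.one .all) = T.counit .projective x

end AlgebraTower

/-! The regular modules behave like the powers of a single primitive element. The tensor product of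
the regular modules of $A_k$ and $A_l$ is the regular module of $A_k\otimes A_l$, and inducing a
regular module gives a regular module (`extProd_regular`, `indHom_regular`). Hence
$[A_k][A_l]=[A_{k+l}]$, that is, $[A_n]=x^n$ with $x=[A_1]$.

Since $A_0\cong\mathbb C$, the degree-zero part is spanned by the unit (`Groth.eq_dimHom_smul`). The
graded bialgebra is therefore connected, and the counit laws force $\Delta x=x\otimes1+1\otimes x$
(`comul_lof_one`). As $\Delta$ is multiplicative, the binomial theorem expands $\Delta(x^n)$. Its
component of bidegree $(k,l)$ gives $[\mathrm{Res}\,A_n]=\binom nk[A_k]\otimes[A_l]$ for $k+l=n$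
(`comulComp_eq_choose_smul`, `Tower.comulComp_regular`).

Restriction preserves dimension, so taking dimensions yields $\dim A_n=\binom nk\dim A_k\dim A_l$
(`Tower.finrank_eq_choose_mul`). With $k=1$ this is the recursion $\dim A_{n+1}=(n+1)\,r\,\dim A_n$,
which starts from $\dim A_0=1$. -/

namespace AlgebraTower

/-! ### Classes of zero, isomorphic and free modules; the Grothendieck group in degree zero. -/

section Classes

variable {B : Type u} [Ring B] [Algebra ℂ B] {κ : ModKind}

/-- For a zero module the identity maps form a short exact sequence $0\to M\to M\to M\to0$, so
$[M]=2[M]$. -/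
theorem Groth.cls_eq_zero (M : KindMod κ B) [Subsingleton M.1.carrier] :
    (Groth.cls M : Groth κ B) = 0 := by
  have h := Groth.isAdditive_cls M M M LinearMap.id LinearMap.id
    ⟨Function.injective_id, fun x => ⟨fun _ => ⟨x, rfl⟩, fun _ => Subsingleton.elim _ _⟩,
      Function.surjective_id⟩
  simpa using h

/-- The only relations come from short exact sequences; an isomorphism is one whose third term is
the zero module. -/
theorem Groth.cls_congr {M N : KindMod κ B} (e : M.1.carrier ≃ₗ[B] N.1.carrier) :
    (Groth.cls M : Groth κ B) = Groth.cls N := by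
  let Z : KindMod κ B := ⟨{ carrier := PUnit.{u + 1} }, by
    cases κ
    · trivial
    · exact inferInstanceAs (Module.Projective B PUnit.{u + 1})⟩
  have : Subsingleton Z.1.carrier := inferInstanceAs (Subsingleton PUnit)
  have h := Groth.isAdditive_cls M N Z e.toLinearMap 0
    ⟨e.injective, fun x => ⟨fun _ => e.surjective x, fun _ => rfl⟩,
      fun x => ⟨0, Subsingleton.elim _ _⟩⟩
  rw [h, Groth.cls_eq_zero Z, add_zero]

variable (B κ) in
/-- The free module of rank `d`. -/
def KindMod.free (d : ℕ) : KindMod κ B :=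
  ⟨{ carrier := Fin d → B }, by
    cases κ
    · trivial
    · exact inferInstanceAs (Module.Projective B (Fin d → B))⟩

theorem dimHom_cls [Module.Finite ℂ B] (M : KindMod κ B) :
    dimHom B κ (Groth.cls M) = Module.finrank ℂ M.1.carrier :=
  Groth.lift_cls _ _ M

/-- Induction on the rank along $0\to B\to B^{d+1}\to B^d\to0$, where the first map is the inclusion
of coordinate $0$ and the second forgets it. -/
theorem Groth.cls_free (d : ℕ) : (Groth.cls (KindMod.free B κ d) : Groth κ B)
    = (d : ℤ) • Groth.cls ⟨FinMod.regular B, κ.mem_regular⟩ := by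
  induction d with
  | zero =>
    have : Subsingleton (KindMod.free B κ 0).1.carrier :=
      inferInstanceAs (Subsingleton (Fin 0 → B))
    rw [Groth.cls_eq_zero, Nat.cast_zero, zero_smul]
  | succ d ih =>
    have h := Groth.isAdditive_cls ⟨FinMod.regular B, κ.mem_regular⟩ (KindMod.free B κ (d + 1))
      (KindMod.free B κ d) (LinearMap.single B (fun _ : Fin (d + 1) => B) 0)
      (LinearMap.funLeft B B Fin.succ)
      ⟨Pi.single_injective (M := fun _ : Fin (d + 1) => B) 0, ?_, ?_⟩
    · rw [h, ih]
      push_cast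
      rw [add_smul, one_smul, add_comm]
    · intro (x : Fin (d + 1) → B)
      constructor
      · intro hx
        refine ⟨x 0, funext fun i => ?_⟩
        refine Fin.cases ?_ (fun i => ?_) i
        · exact Pi.single_eq_same (M := fun _ : Fin (d + 1) => B) 0 (x 0)
        · exact (Pi.single_eq_of_ne (M := fun _ : Fin (d + 1) => B) (Fin.succ_ne_zero i) (x 0)).trans
            (congrFun hx i).symm
      · rintro ⟨y, rfl⟩
        exact funext fun i =>
          Pi.single_eq_of_ne (M := fun _ : Fin (d + 1) => B) (Fin.succ_ne_zero i) y
    · exact LinearMap.funLeft_surjective_of_injective B B _ (Fin.succ_injective d)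

/-- The Grothendieck group of an algebra isomorphic to `ℂ` is generated by the regular module. -/
theorem Groth.eq_dimHom_smul [Module.Finite ℂ B] (e : B ≃ₐ[ℂ] ℂ) (x : Groth κ B) :
    x = dimHom B κ x • (Groth.cls ⟨FinMod.regular B, κ.mem_regular⟩ : Groth κ B) := by
  have : (LinearMap.id : Groth κ B →ₗ[ℤ] Groth κ B) = (dimHom B κ).smulRight
      (Groth.cls ⟨FinMod.regular B, κ.mem_regular⟩ : Groth κ B) := by
    refine Groth.hom_ext fun M => ?_
    have := M.1.finite_complex
    rw [LinearMap.id_apply, LinearMap.smulRight_apply, dimHom_cls, ← Groth.cls_free]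
    have hB : Module.finrank ℂ B = 1 := by
      rw [e.toLinearEquiv.finrank_eq, Module.finrank_self]
    -- As $\dim B=1$, the free module of rank $\dim M$ has the same complex dimension as $M$, so a
    -- complex-linear isomorphism exists.
    let f : M.1.carrier ≃ₗ[ℂ] (Fin (Module.finrank ℂ M.1.carrier) → B) :=
      LinearEquiv.ofFinrankEq _ _ (by rw [Module.finrank_pi_fintype]; simp [hB])
    refine Groth.cls_congr ({ f with map_smul' := fun b x => ?_ } :
      M.1.carrier ≃ₗ[B] (Fin (Module.finrank ℂ M.1.carrier) → B))
    -- Every element of $B$ is a scalar, so complex linearity of `f` already gives $B$-linearity.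
    obtain ⟨z, rfl⟩ : ∃ z, b = algebraMap ℂ B z := ⟨e b, by
      rw [← AlgEquiv.commutes e.symm]; simp⟩
    change f _ = algebraMap ℂ B z • f x
    rw [algebraMap_smul, algebraMap_smul, map_smul]
  exact LinearMap.congr_fun this x

end Classes

/-! ### Regular modules under tensor product and induction; dimensions under tensor product and
restriction. -/

section Regular

variable {B C : Type u} [Ring B] [Algebra ℂ B] [Ring C] [Algebra ℂ C]
  {κ : ModKind}

theorem extProd_cls (M : KindMod κ B) (N : KindMod κ C) :
    extProd κ B C (Groth.cls M) (Groth.cls N) = Groth.cls (M.tensor N) :=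
  Groth.lift₂_cls _ _ _ M N

/-- The module induced from the regular module is the regular module. -/
noncomputable def Ind.regularEquiv (φ : B →ₐ[ℂ] C) : Ind φ B ≃ₗ[C] C :=
  LinearEquiv.ofLinearMap
    -- The map $c\otimes b\mapsto c\,\varphi(b)$, with inverse $c\mapsto c\cdot(1\otimes1)$. Each
    -- composite is checked on generators only.
    (Ind.lift φ (X := B) (W := C) φ.toLinearMap (map_mul φ))
    (LinearMap.toSpanSingleton C (Ind φ B) ((indRelations φ B).mkQ (1 ⊗ₜ[ℂ] (1 : B))))
    (LinearMap.ext_ring (by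
      rw [LinearMap.comp_apply, LinearMap.toSpanSingleton_apply, one_smul]
      refine (Ind.lift_mk φ (X := B) (W := C) φ.toLinearMap (map_mul φ) 1 1).trans ?_
      rw [one_smul]
      exact map_one φ))
    -- Here $1\otimes x\mapsto\varphi(x)\mapsto\varphi(x)\otimes1=1\otimes x$, the last equality
    -- being the defining relation of the induced module.
    (Ind.hom_ext φ fun x => by
      refine (congrArg (LinearMap.toSpanSingleton C (Ind φ B) _)
        (Ind.lift_mk φ (X := B) (W := C) φ.toLinearMap (map_mul φ) 1 x)).trans ?_
      rw [LinearMap.toSpanSingleton_apply, one_smul,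
        AlgHom.toLinearMap_apply, ← map_smul, TensorProduct.smul_tmul', smul_eq_mul, mul_one,
        LinearMap.id_apply, ← one_mul (φ x), Ind.mk_smul, smul_eq_mul, mul_one])

theorem indHom_regular (φ : B →ₐ[ℂ] C) (hφ : RightProjective φ) :
    indHom κ φ hφ (Groth.cls ⟨FinMod.regular B, κ.mem_regular⟩)
      = Groth.cls ⟨FinMod.regular C, κ.mem_regular⟩ :=
  (Groth.lift_cls _ _ _).trans (Groth.cls_congr (Ind.regularEquiv φ))

theorem extProd_regular :
    extProd κ B C (Groth.cls ⟨FinMod.regular B, κ.mem_regular⟩)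
      (Groth.cls ⟨FinMod.regular C, κ.mem_regular⟩)
      = Groth.cls ⟨FinMod.regular (B ⊗[ℂ] C), κ.mem_regular⟩ := by
  rw [extProd_cls]
  -- The identity map is linear because the external action on pure tensors is the multiplication of
  -- $B\otimes C$.
  let f : letI := tensorModule B C B C
      B ⊗[ℂ] C →ₗ[B ⊗[ℂ] C] (FinMod.regular (B ⊗[ℂ] C)).carrier :=
    tensorLinear (AddMonoidHom.id (B ⊗[ℂ] C)) fun a b m n =>
      (Algebra.TensorProduct.tmul_mul_tmul a m b n).symm
  exact Groth.cls_congr (LinearEquiv.ofBijective f Function.bijective_id)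

/-- A nonzero value of `extProdInv` is a preimage under the external product: it can only occur
where the external product is bijective. -/
theorem lift_extProd_extProdInv {x : Groth κ (B ⊗[ℂ] C)} (hx : extProdInv κ B C x ≠ 0) :
    TensorProduct.lift (extProd κ B C) (extProdInv κ B C x) = x := by
  by_cases h : Function.Bijective (TensorProduct.lift (extProd κ B C))
  · have hinv : extProdInv κ B C
        = (LinearEquiv.ofBijective (TensorProduct.lift (extProd κ B C)) h).symm.toLinearMap :=
      dif_pos h
    rw [hinv]
    exact (LinearEquiv.ofBijective (TensorProduct.lift (extProd κ B C)) h).apply_symm_apply x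
  · have hinv : extProdInv κ B C = 0 := dif_neg h
    exact absurd (LinearMap.congr_fun hinv x) hx

variable [Module.Finite ℂ B] [Module.Finite ℂ C]

theorem dimHom_extProd (x : Groth κ B) (y : Groth κ C) :
    dimHom (B ⊗[ℂ] C) κ (extProd κ B C x y) = dimHom B κ x * dimHom C κ y := by
  have : (extProd κ B C).compr₂ (dimHom (B ⊗[ℂ] C) κ)
      = (LinearMap.mul ℤ ℤ).compl₁₂ (dimHom B κ) (dimHom C κ) := by
    refine Groth.hom_ext fun M => Groth.hom_ext fun N => ?_
    rw [LinearMap.compr₂_apply, LinearMap.compl₁₂_apply, extProd_cls, dimHom_cls, dimHom_cls,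
      dimHom_cls]
    change (Module.finrank ℂ (M.1.carrier ⊗[ℂ] N.1.carrier) : ℤ) = _ * _
    rw [Module.finrank_tensorProduct]
    push_cast
    rfl
  exact LinearMap.congr_fun (LinearMap.congr_fun this x) y

/-- Restriction leaves the underlying complex vector space unchanged. -/
theorem dimHom_resHom (φ : B →ₐ[ℂ] C) (hφ : LeftProjective φ) (x : Groth κ C) :
    dimHom B κ (resHom κ φ hφ x) = dimHom C κ x := by
  have : dimHom B κ ∘ₗ resHom κ φ hφ = dimHom C κ := by
    refine Groth.hom_ext fun M => ?_
    rw [LinearMap.comp_apply, dimHom_cls]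
    exact (congrArg _ (Groth.lift_cls _ _ M)).trans (dimHom_cls _)
  exact LinearMap.congr_fun this x

theorem dimHom_regular : dimHom B κ (Groth.cls ⟨FinMod.regular B, κ.mem_regular⟩)
    = Module.finrank ℂ B :=
  dimHom_cls _

/-- The functional `dim ⊗ dim` on the tensor product of two Grothendieck groups. -/
noncomputable def dimHom₂ (κ : ModKind) (B C : Type u) [Ring B] [Algebra ℂ B] [Ring C]
    [Algebra ℂ C] [Module.Finite ℂ B] [Module.Finite ℂ C] :
    Groth κ B ⊗[ℤ] Groth κ C →+ ℤ :=
  (TensorProduct.lift ((LinearMap.mul ℤ ℤ).compl₁₂ (dimHom B κ) (dimHom C κ))).toAddMonoidHom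

theorem dimHom₂_tmul (x : Groth κ B) (y : Groth κ C) :
    dimHom₂ κ B C (x ⊗ₜ y) = dimHom B κ x * dimHom C κ y := rfl

/-- Together with `lift_extProd_extProdInv`, this reads the dimension of a restricted module off its
decomposition in the tensor product of Grothendieck groups. -/
theorem dimHom_lift_extProd (t : Groth κ B ⊗[ℤ] Groth κ C) :
    dimHom (B ⊗[ℂ] C) κ (TensorProduct.lift (extProd κ B C) t) = dimHom₂ κ B C t := by
  induction t with
  | zero => rw [map_zero, map_zero, map_zero]
  | add x y hx hy => rw [map_add, map_add, map_add, hx, hy]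
  | tmul y z => exact dimHom_extProd y z

end Regular

/-! ### Primitive elements and their powers in connected graded Hopf algebras. -/

section GradedHopf

variable {R : Type} [CommRing R] {M : ℕ → Type u} [∀ n, AddCommGroup (M n)] [∀ n, Module R (M n)]

theorem component_lof_of_ne {i k : ℕ} (h : i ≠ k) (x : M i) :
    DirectSum.component R ℕ M k (DirectSum.lof R ℕ M i x) = 0 := by
  rw [DirectSum.component.of, dif_neg h]

/-- With `map_component_map_lof`, this isolates one bidegree of a comultiplication: projecting to
$(k,l)$ discards all other summands. -/
theorem map_component_map_lof_of_ne {k l i j : ℕ} (h : (i, j) ≠ (k, l)) (t : M i ⊗[R] M j) :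
    TensorProduct.map (DirectSum.component R ℕ M k) (DirectSum.component R ℕ M l)
      (TensorProduct.map (DirectSum.lof R ℕ M i) (DirectSum.lof R ℕ M j) t) = 0 := by
  induction t with
  | zero => simp
  | add x y hx hy => rw [map_add, map_add, hx, hy, add_zero]
  | tmul x y =>
    rw [TensorProduct.map_tmul, TensorProduct.map_tmul]
    by_cases hi : i = k
    · have hj : j ≠ l := fun hj => h (by rw [hi, hj])
      rw [component_lof_of_ne hj, TensorProduct.tmul_zero]
    · rw [component_lof_of_ne hi, TensorProduct.zero_tmul]

theorem map_component_map_lof {k l : ℕ} (t : M k ⊗[R] M l) :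
    TensorProduct.map (DirectSum.component R ℕ M k) (DirectSum.component R ℕ M l)
      (TensorProduct.map (DirectSum.lof R ℕ M k) (DirectSum.lof R ℕ M l) t) = t := by
  induction t with
  | zero => simp
  | add x y hx hy => rw [map_add, map_add, hx, hy]
  | tmul x y =>
    rw [TensorProduct.map_tmul, TensorProduct.map_tmul, DirectSum.component.lof_self,
      DirectSum.component.lof_self]

variable {counit : (⨁ n, M n) →ₗ[R] R} {one : ⨁ n, M n}

theorem rTensor_counit_map_lof (hpos : ∀ n, n ≠ 0 → ∀ x, counit (DirectSum.lof R ℕ M n x) = 0)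
    {i j : ℕ} (hi : i ≠ 0) (t : M i ⊗[R] M j) :
    counit.rTensor _ (TensorProduct.map (DirectSum.lof R ℕ M i) (DirectSum.lof R ℕ M j) t)
      = 0 := by
  induction t with
  | zero => simp
  | add x y hx hy => rw [map_add, map_add, hx, hy, add_zero]
  | tmul x y =>
    rw [TensorProduct.map_tmul, LinearMap.rTensor_tmul, hpos i hi, TensorProduct.zero_tmul]

theorem lTensor_counit_map_lof (hpos : ∀ n, n ≠ 0 → ∀ x, counit (DirectSum.lof R ℕ M n x) = 0)
    {i j : ℕ} (hj : j ≠ 0) (t : M i ⊗[R] M j) :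
    counit.lTensor _ (TensorProduct.map (DirectSum.lof R ℕ M i) (DirectSum.lof R ℕ M j) t)
      = 0 := by
  induction t with
  | zero => simp
  | add x y hx hy => rw [map_add, map_add, hx, hy, add_zero]
  | tmul x y =>
    rw [TensorProduct.map_tmul, LinearMap.lTensor_tmul, hpos j hj, TensorProduct.tmul_zero]

/-- Degree zero is spanned by the unit, so a tensor with left factor in degree zero has the form
$1\otimes y$; applying the counit on the left recovers $y$. -/
theorem map_lof_zero_left
    (hzero : ∀ x, DirectSum.lof R ℕ M 0 x = counit (DirectSum.lof R ℕ M 0 x) • one) {j : ℕ}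
    (t : M 0 ⊗[R] M j) :
    TensorProduct.map (DirectSum.lof R ℕ M 0) (DirectSum.lof R ℕ M j) t
      = one ⊗ₜ[R] TensorProduct.lid R _ (counit.rTensor _
        (TensorProduct.map (DirectSum.lof R ℕ M 0) (DirectSum.lof R ℕ M j) t)) := by
  induction t with
  | zero => simp
  | add x y hx hy => simp only [map_add, TensorProduct.tmul_add, ← hx, ← hy]
  | tmul x y =>
    rw [TensorProduct.map_tmul, LinearMap.rTensor_tmul, TensorProduct.lid_tmul,
      TensorProduct.tmul_smul, TensorProduct.smul_tmul', ← hzero]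

theorem map_lof_zero_right
    (hzero : ∀ x, DirectSum.lof R ℕ M 0 x = counit (DirectSum.lof R ℕ M 0 x) • one) {i : ℕ}
    (t : M i ⊗[R] M 0) :
    TensorProduct.map (DirectSum.lof R ℕ M i) (DirectSum.lof R ℕ M 0) t
      = TensorProduct.rid R _ (counit.lTensor _
        (TensorProduct.map (DirectSum.lof R ℕ M i) (DirectSum.lof R ℕ M 0) t)) ⊗ₜ[R] one := by
  induction t with
  | zero => simp
  | add x y hx hy => simp only [map_add, TensorProduct.add_tmul, ← hx, ← hy]
  | tmul x y =>
    rw [TensorProduct.map_tmul, LinearMap.lTensor_tmul, TensorProduct.rid_tmul,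
      TensorProduct.smul_tmul, ← hzero]

variable {comul : (⨁ n, M n) →ₗ[R] (⨁ n, M n) ⊗[R] (⨁ n, M n)}
  {c : ∀ k l n, k + l = n → M n → M k ⊗[R] M l}

/-- In a connected graded coalgebra the elements of degree `1` are primitive. -/
theorem comul_lof_one
    (hcomul : ∀ n x, comul (DirectSum.lof R ℕ M n x)
      = ∑ p ∈ (Finset.HasAntidiagonal.antidiagonal n).attach,
        TensorProduct.map (DirectSum.lof R ℕ M p.1.1) (DirectSum.lof R ℕ M p.1.2)
          (c p.1.1 p.1.2 n (Finset.HasAntidiagonal.mem_antidiagonal.1 p.2) x))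
    (hpos : ∀ n, n ≠ 0 → ∀ x, counit (DirectSum.lof R ℕ M n x) = 0)
    (hzero : ∀ x, DirectSum.lof R ℕ M 0 x = counit (DirectSum.lof R ℕ M 0 x) • one)
    (hl : ∀ y, TensorProduct.lid R _ (counit.rTensor _ (comul y)) = y)
    (hr : ∀ y, TensorProduct.rid R _ (counit.lTensor _ (comul y)) = y) (x : M 1) :
    comul (DirectSum.lof R ℕ M 1 x)
      = DirectSum.lof R ℕ M 1 x ⊗ₜ[R] one + one ⊗ₜ[R] DirectSum.lof R ℕ M 1 x := by
  have hsum : comul (DirectSum.lof R ℕ M 1 x)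
      = TensorProduct.map (DirectSum.lof R ℕ M 0) (DirectSum.lof R ℕ M 1) (c 0 1 1 rfl x)
        + TensorProduct.map (DirectSum.lof R ℕ M 1) (DirectSum.lof R ℕ M 0) (c 1 0 1 rfl x) := by
    have huniv : (Finset.HasAntidiagonal.antidiagonal 1).attach
        = {⟨((0, 1) : ℕ × ℕ), by decide⟩, ⟨((1, 0) : ℕ × ℕ), by decide⟩} := by decide
    rw [hcomul, huniv, Finset.sum_pair (by decide)]
  -- The left counit law kills the $(1,0)$ part, since the counit vanishes in degree $1$. Hence the
  -- $(0,1)$ part is $1\otimes x$; symmetrically, `h1` makes the $(1,0)$ part $x\otimes1$.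
  have h0 := hl (DirectSum.lof R ℕ M 1 x)
  rw [hsum, map_add, rTensor_counit_map_lof hpos one_ne_zero, add_zero] at h0
  have h1 := hr (DirectSum.lof R ℕ M 1 x)
  rw [hsum, map_add, lTensor_counit_map_lof hpos one_ne_zero, zero_add] at h1
  rw [hsum, map_lof_zero_left hzero, map_lof_zero_right hzero, h0, h1, add_comm]

variable {mul : (⨁ n, M n) →ₗ[R] (⨁ n, M n) →ₗ[R] ⨁ n, M n} {r : ∀ n, M n}

/-- In a connected graded Hopf algebra the powers `r n` of an element `r 1` of degree `1` are a
sequence of binomial type. -/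
theorem comulComp_eq_choose_smul (hH : FormsHopfAlgebra mul one comul counit)
    (hcomul : ∀ n x, comul (DirectSum.lof R ℕ M n x)
      = ∑ p ∈ (Finset.HasAntidiagonal.antidiagonal n).attach,
        TensorProduct.map (DirectSum.lof R ℕ M p.1.1) (DirectSum.lof R ℕ M p.1.2)
          (c p.1.1 p.1.2 n (Finset.HasAntidiagonal.mem_antidiagonal.1 p.2) x))
    (hpos : ∀ n, n ≠ 0 → ∀ x, counit (DirectSum.lof R ℕ M n x) = 0)
    (hzero : ∀ x, DirectSum.lof R ℕ M 0 x = counit (DirectSum.lof R ℕ M 0 x) • one)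
    (hone : one = DirectSum.lof R ℕ M 0 (r 0))
    (hmul : ∀ k l, mul (DirectSum.lof R ℕ M k (r k)) (DirectSum.lof R ℕ M l (r l))
      = DirectSum.lof R ℕ M (k + l) (r (k + l)))
    (k l n : ℕ) (h : k + l = n) : c k l n h (r n) = n.choose k • (r k ⊗ₜ[R] r l) := by
  obtain ⟨S, _, _, e, emul, eone, ecomul, ecounit⟩ := hH
  -- The two counit laws are carried from `S` to the direct sum along `e`.
  have hl : ∀ y, TensorProduct.lid R _ (counit.rTensor _ (comul y)) = y := by
    intro y
    obtain ⟨y, rfl⟩ := e.surjective y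
    have key : ∀ t : S ⊗[R] S, TensorProduct.lid R _ (counit.rTensor _
        (TensorProduct.map e.toLinearMap e.toLinearMap t))
        = e (TensorProduct.lid R _ ((Coalgebra.counit (R := R) (A := S)).rTensor _ t)) := by
      intro t
      induction t with
      | zero => simp
      | add x y hx hy => simp only [map_add, hx, hy]
      | tmul x y => simp [ecounit]
    rw [← ecomul, key, Coalgebra.rTensor_counit_comul, TensorProduct.lid_tmul, one_smul]
  have hr : ∀ y, TensorProduct.rid R _ (counit.lTensor _ (comul y)) = y := by
    intro y
    obtain ⟨y, rfl⟩ := e.surjective y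
    have key : ∀ t : S ⊗[R] S, TensorProduct.rid R _ (counit.lTensor _
        (TensorProduct.map e.toLinearMap e.toLinearMap t))
        = e (TensorProduct.rid R _ ((Coalgebra.counit (R := R) (A := S)).lTensor _ t)) := by
      intro t
      induction t with
      | zero => simp
      | add x y hx hy => simp only [map_add, hx, hy]
      | tmul x y => simp [ecounit]
    rw [← ecomul, key, Coalgebra.lTensor_counit_comul, TensorProduct.rid_tmul, one_smul]
  obtain ⟨x, hx⟩ := e.surjective (DirectSum.lof R ℕ M 1 (r 1))
  -- The elements `r m` correspond to powers of one element, so the ordinary ring structure of `S`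
  -- can be used.
  have hpow : ∀ m, e (x ^ m) = DirectSum.lof R ℕ M m (r m) := by
    intro m
    induction m with
    | zero => rw [pow_zero, eone, hone]
    | succ m ih => rw [pow_succ, emul, ih, hx, hmul]
  have hprim : Coalgebra.comul (R := R) x = x ⊗ₜ[R] (1 : S) + (1 : S) ⊗ₜ[R] x := by
    apply (TensorProduct.congr e e).injective
    change TensorProduct.map e.toLinearMap e.toLinearMap _
      = TensorProduct.map e.toLinearMap e.toLinearMap _
    rw [ecomul, hx, comul_lof_one hcomul hpos hzero hl hr, map_add, TensorProduct.map_tmul,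
      TensorProduct.map_tmul]
    simp only [LinearEquiv.coe_coe, hx, eone]
  -- This commutation is what the binomial theorem needs; `S` itself need not be commutative.
  have hcomm : Commute (x ⊗ₜ[R] (1 : S)) ((1 : S) ⊗ₜ[R] x) := by
    simp [Commute, SemiconjBy]
  have hbinom : comul (DirectSum.lof R ℕ M n (r n))
      = ∑ p ∈ Finset.HasAntidiagonal.antidiagonal n, n.choose p.1 •
        TensorProduct.map (DirectSum.lof R ℕ M p.1) (DirectSum.lof R ℕ M p.2)
          (r p.1 ⊗ₜ[R] r p.2) := by
    rw [← hpow, ← ecomul, Bialgebra.comul_pow, hprim, hcomm.add_pow', map_sum]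
    refine Finset.sum_congr rfl fun p _ => ?_
    rw [map_nsmul, Algebra.TensorProduct.tmul_pow, Algebra.TensorProduct.tmul_pow, one_pow,
      one_pow, Algebra.TensorProduct.tmul_mul_tmul, one_mul, mul_one, TensorProduct.map_tmul,
      TensorProduct.map_tmul]
    simp only [LinearEquiv.coe_coe, hpow]
  -- The graded formula for the comultiplication and the binomial expansion are compared in bidegree
  -- $(k,l)$, where a single summand survives on each side.
  have hcomp := congrArg (TensorProduct.map (DirectSum.component R ℕ M k)
    (DirectSum.component R ℕ M l)) ((hcomul n (r n)).symm.trans hbinom)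
  rw [map_sum, map_sum, Finset.sum_eq_single (k, l),
    Finset.sum_eq_single (⟨(k, l), Finset.HasAntidiagonal.mem_antidiagonal.2 h⟩ :
      {p // p ∈ Finset.HasAntidiagonal.antidiagonal n}),
    map_nsmul, map_component_map_lof, map_component_map_lof] at hcomp
  · exact hcomp
  · exact fun p _ hp => map_component_map_lof_of_ne (fun h => hp (Subtype.ext h)) _
  · exact fun h => absurd (Finset.mem_attach _ _) h
  · intro p _ hp
    rw [map_nsmul, map_component_map_lof_of_ne hp, smul_zero]
  · exact fun h' => absurd (Finset.HasAntidiagonal.mem_antidiagonal.2 h) h'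

end GradedHopf

/-! ### The binomial recursion for the dimensions of a tower. -/

namespace Tower

variable (T : Tower.{u}) (κ : ModKind)

theorem mul_lof (k l : ℕ) (x : Groth κ (T.A k)) (y : Groth κ (T.A l)) :
    T.mul κ (DirectSum.lof ℤ ℕ (fun n => Groth κ (T.A n)) k x)
      (DirectSum.lof ℤ ℕ (fun n => Groth κ (T.A n)) l y)
      = DirectSum.lof ℤ ℕ (fun n => Groth κ (T.A n)) (k + l) (T.mulComp κ k l x y) := by
  simp [mul, DirectSum.toModule_lof]

variable {T κ}

/-- If `K(A)` or `G(A)` is a Hopf algebra, then the restriction of the regular `Aₙ`-module to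
`Aₖ ⊗ Aₗ` is, in the Grothendieck group, `n.choose k` times the regular module. -/
theorem comulComp_regular
    (hH : FormsHopfAlgebra (T.mul κ) (T.one κ) (T.comul κ) (T.counit κ)) (k l n : ℕ)
    (h : k + l = n) :
    T.comulComp κ k l n h (Groth.cls ⟨FinMod.regular (T.A n), κ.mem_regular⟩)
      = n.choose k • (Groth.cls ⟨FinMod.regular (T.A k), κ.mem_regular⟩ ⊗ₜ[ℤ]
          Groth.cls ⟨FinMod.regular (T.A l), κ.mem_regular⟩) := by
  refine comulComp_eq_choose_smul (M := fun n => Groth κ (T.A n))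
    (c := fun k l n h x => T.comulComp κ k l n h x)
    (r := fun n => Groth.cls ⟨FinMod.regular (T.A n), κ.mem_regular⟩) hH ?_ ?_ ?_ rfl ?_ k l n h
  · intro n x
    refine (DirectSum.toModule_lof (M := fun n => Groth κ (T.A n)) ℤ n x).trans ?_
    rw [LinearMap.sum_apply]
    rfl
  · intro n hn x
    exact (congrArg (dimHom (T.A 0) κ)
      (component_lof_of_ne (M := fun n => Groth κ (T.A n)) hn x)).trans (map_zero _)
  -- Connectedness: because $A_0\cong\mathbb C$, each class in degree zero is its dimension times
  -- the unit.
  · intro x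
    obtain ⟨e⟩ := T.zero_equiv
    have hx : T.counit κ (DirectSum.lof ℤ ℕ (fun n => Groth κ (T.A n)) 0 x)
        = dimHom (T.A 0) κ x :=
      congrArg (dimHom (T.A 0) κ)
        (DirectSum.component.lof_self ℤ (M := fun n => Groth κ (T.A n)) 0 x)
    rw [hx, one, ← map_smul, ← Groth.eq_dimHom_smul e]
  -- Multiplicativity $[A_k][A_l]=[A_{k+l}]$.
  · intro k l
    rw [mul_lof, mulComp, LinearMap.compr₂_apply, extProd_regular, indHom_regular]

/-- If `K(A)` or `G(A)` is a Hopf algebra then `dim Aₙ = (n choose k) dim Aₖ dim Aₗ`, where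
`n = k + l`. -/
theorem finrank_eq_choose_mul
    (hH : FormsHopfAlgebra (T.mul κ) (T.one κ) (T.comul κ) (T.counit κ)) (k l n : ℕ)
    (h : k + l = n) : Module.finrank ℂ (T.A n)
      = n.choose k * (Module.finrank ℂ (T.A k) * Module.finrank ℂ (T.A l)) := by
  have hcomp := comulComp_regular hH k l n h
  have hdim := congrArg (dimHom₂ κ (T.A k) (T.A l)) hcomp
  rw [map_nsmul, dimHom₂_tmul, dimHom_regular, dimHom_regular, nsmul_eq_mul] at hdim
  -- `extProdInv` defaults to zero unless the external product is bijective, and it preserves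
  -- dimension only in the bijective case. A nonzero value rules out the default, so vanishing
  -- dimensions need a separate argument.
  by_cases h0 : Module.finrank ℂ (T.A k) * Module.finrank ℂ (T.A l) = 0
  · have : Subsingleton (T.A k ⊗[ℂ] T.A l) := by
      rw [← Module.finrank_zero_iff (R := ℂ), Module.finrank_tensorProduct, h0]
    -- As `T.ρ k l n h` is unital, a zero algebra $A_k\otimes A_l$ forces $A_n=0$, and both sides
    -- vanish.
    have h1 : (1 : T.A n) = 0 := by
      rw [← map_one (T.ρ k l n h), Subsingleton.elim (1 : T.A k ⊗[ℂ] T.A l) 0, map_zero]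
    have := subsingleton_of_zero_eq_one h1.symm
    rw [h0, mul_zero, Module.finrank_zero_of_subsingleton]
  -- The value has dimension $\binom nk\dim A_k\dim A_l\ne0$, so it is a genuine preimage of the
  -- restricted class under the external product.
  · have hne : T.comulComp κ k l n h
        (Groth.cls ⟨FinMod.regular (T.A n), κ.mem_regular⟩) ≠ 0 := by
      intro hz
      rw [hz, map_zero] at hdim
      have hc : n.choose k ≠ 0 := (Nat.choose_pos (by omega)).ne'
      exact mul_ne_zero hc h0 (by exact_mod_cast hdim.symm)
    have hres := congrArg (dimHom (T.A k ⊗[ℂ] T.A l) κ) (lift_extProd_extProdInv hne)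
    rw [dimHom_lift_extProd, dimHom_resHom, dimHom_regular] at hres
    exact_mod_cast hres.symm.trans hdim

end Tower

end AlgebraTower

theorem theorem1 (T : AlgebraTower.Tower.{u}) (hT : T.FormsDualHopfAlgebras) (n : ℕ) :
    Module.finrank ℂ (T.A n) = Module.finrank ℂ (T.A 1) ^ n * n.factorial := by
  induction n with
  | zero =>
    obtain ⟨e⟩ := T.zero_equiv
    rw [e.toLinearEquiv.finrank_eq, Module.finrank_self, pow_zero, Nat.factorial_zero, mul_one]
  | succ n ih =>
    -- Splitting off one degree, $k=1$, makes the binomial coefficient $n+1$, the new factor of the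
    -- factorial.
    rw [T.finrank_eq_choose_mul (hT.hopf .projective) 1 n (n + 1) (Nat.add_comm 1 n), ih,
      Nat.choose_one_right, Nat.factorial_succ, pow_succ]
    ring
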